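/- Let $C\subset\mathbb{R}^d$ be a full-dimensional pointed polyhedral cone, that is, $C$ is the intersection of finitely many linear half-spaces $\{x:\lambda(x)\ge 0\}$, $\dim C=d$, and $x,-x\in C$ implies $x=0$. A face of $C$ is either $C$ itself or a nonempty intersection $C\cap H$, where $H$ is a hyperplane such that $C$ lies in one of the two closed half-spaces bounded by $H$; the dimension of a face is the dimension of its affine hull, and a facet is a face of dimension $\dim C-1$. Let $F$ be a face of $C$ and let $c=\operatorname{codim}F=\dim C-\dim F$. Then $F$ is cosimplicial, i.e. $F$ is contained in exactly $c$ facets of $C$, if and only if $F$ is not the intersection of fewer than $c$ facets of $C$ (the intersection of no facets being $C$). -/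

import Mathlib

/-- The dimension of a (nonempty) subset of a real vector space: the dimension of its affine hull. -/
noncomputable def hullDim {E : Type*} [AddCommGroup E] [Module ℝ E] (s : Set E) : ℕ :=
  Module.finrank ℝ (affineSpan ℝ s).direction

/-- `F` is a (nonempty) face of `P`: either `F` is `P` itself (the improper face) or `F` is the
nonempty intersection of `P` with a supporting hyperplane `{x | l x = a}`, `l ≠ 0`, such that `P`
lies in the closed half-space `{x | a ≤ l x}`. -/
def IsPolyFace {E : Type*} [AddCommGroup E] [Module ℝ E] (P F : Set E) : Prop :=
  F = P ∨ (F.Nonempty ∧ ∃ l : Module.Dual ℝ E, ∃ a : ℝ, l ≠ 0 ∧ (∀ x ∈ P, a ≤ l x) ∧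
    F = {x | x ∈ P ∧ l x = a})

/-- A facet of `P` is a face of dimension `dim P - 1`. -/
def IsPolyFacet {E : Type*} [AddCommGroup E] [Module ℝ E] (P H : Set E) : Prop :=
  IsPolyFace P H ∧ hullDim H + 1 = hullDim P

/-- The codimension `dim P - dim F` of a face `F` of `P`. -/
noncomputable def faceCodim {E : Type*} [AddCommGroup E] [Module ℝ E] (P F : Set E) : ℕ :=
  hullDim P - hullDim F

/-- A face `F` of `P` is cosimplicial if it is contained in exactly `codim F` facets of `P`. -/
def IsCosimplicialFace {E : Type*} [AddCommGroup E] [Module ℝ E] (P F : Set E) : Prop :=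
  {H : Set E | IsPolyFacet P H ∧ F ⊆ H}.encard = (faceCodim P F : ℕ∞)

/-- `F` is the intersection of fewer than `k` facets of `P`. The intersection is formed inside `P`,
so that the empty intersection is `P`. -/
def IsInterOfFewerFacets {E : Type*} [AddCommGroup E] [Module ℝ E] (P F : Set E) (k : ℕ) : Prop :=
  ∃ S : Finset (Set E), S.card < k ∧ (∀ H ∈ S, IsPolyFacet P H) ∧ F = P ∩ ⋂ H ∈ S, H

/-!
Write the cone as `C = {x | ∀ f ∈ s, 0 ≤ f x}` with an irredundant finite set `s` of functionals.
Then `f ↦ C ∩ ker f` is a bijection from `s` onto the facets of `C` (`isPolyFacet_iff`,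
`polyFacet_injOn`). For a face `F` let `t ⊆ s` be the set of functionals that vanish on `F`. A point
of `F` at which every functional of `s \ t` is positive (`exists_relInterior`) shows that the linear
span of `F` is the common kernel of `t`, so `codim F = dim (span t)` (`faceCodim_eq`), while the
facets containing `F` are counted by `t`. Hence `F` is cosimplicial exactly when `t` is linearly
independent.

If `t` is linearly independent and fewer than `codim F` facets are given, some `f ∈ t` is left out;
moving from a relative interior point of `F` in a direction on which `f` is positive and the rest of
`t` vanishes stays in `C` and in all the given facets but leaves `F`
(`not_isInterOfFewerFacets`).

If `t` is linearly dependent, the argument is that of Radon's theorem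
(`isInterOfFewerFacets`). Take `codim F + 1` members of `t` that span the same space as `t`, and a
nontrivial linear relation between them. At least two coefficients are negative: otherwise all of
the functionals but one would have nonnegative coefficients, and a point of `C` on which that one
vanishes and all the others are positive would make the relation trivial. The facets with a
nonnegative coefficient, at most `codim F - 1` in number, already cut out `F`: where their
functionals vanish, the relation becomes a vanishing sum of terms of one sign.
-/

open Module

/-- The polyhedral cone on which all the functionals in `s` are nonnegative. -/
def polyCone {V : Type*} [AddCommGroup V] [Module ℝ V] (s : Finset (Dual ℝ V)) : Set V :=
  {x | ∀ f ∈ s, 0 ≤ f x}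

/-- The face of `polyCone s` cut out by the hyperplane `f = 0`. -/
def polyFacet {V : Type*} [AddCommGroup V] [Module ℝ V] (s : Finset (Dual ℝ V))
    (f : Dual ℝ V) : Set V :=
  {x | x ∈ polyCone s ∧ f x = 0}

/-- No functional in `s` can be dropped without enlarging `polyCone s`: for each `f ∈ s` some point
violates the inequality of `f` and satisfies all the others. In particular `0 ∉ s`. -/
def IsIrredundant {V : Type*} [AddCommGroup V] [Module ℝ V] (s : Finset (Dual ℝ V)) : Prop :=
  ∀ f ∈ s, ∃ y, f y < 0 ∧ ∀ g ∈ s, g ≠ f → 0 ≤ g y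

open Classical in
/-- The functionals of `s` that vanish identically on `F`. -/
noncomputable def activeSet {V : Type*} [AddCommGroup V] [Module ℝ V] (s : Finset (Dual ℝ V))
    (F : Set V) : Finset (Dual ℝ V) :=
  s.filter fun f => ∀ x ∈ F, f x = 0

section PolyCone

variable {V : Type*} [AddCommGroup V] [Module ℝ V] {s : Finset (Dual ℝ V)} {F : Set V}

lemma mem_activeSet {f : Dual ℝ V} : f ∈ activeSet s F ↔ f ∈ s ∧ ∀ x ∈ F, f x = 0 := by
  classical
  simp [activeSet]

lemma zero_mem_polyCone (s : Finset (Dual ℝ V)) : (0 : V) ∈ polyCone s := by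
  simp [polyCone]

lemma smul_mem_polyCone {x : V} (hx : x ∈ polyCone s) {a : ℝ} (ha : 0 ≤ a) :
    a • x ∈ polyCone s := by
  intro f hf
  simpa using mul_nonneg ha (hx f hf)

lemma sum_mem_polyCone {ι : Type*} {t : Finset ι} {x : ι → V} (hx : ∀ i ∈ t, x i ∈ polyCone s) :
    ∑ i ∈ t, x i ∈ polyCone s := by
  intro f hf
  simpa using Finset.sum_nonneg fun i hi => hx i hi f hf

/-- Every finite system of inequalities contains an irredundant one with the same solutions. -/
lemma exists_isIrredundant (s : Finset (Dual ℝ V)) :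
    ∃ t : Finset (Dual ℝ V), IsIrredundant t ∧ polyCone t = polyCone s := by
  classical
  induction s using Finset.strongInduction with
  | H s ih =>
    by_cases h : IsIrredundant s
    · exact ⟨s, h, rfl⟩
    · unfold IsIrredundant at h
      push Not at h
      obtain ⟨f, hf, h⟩ := h
      obtain ⟨t, ht, hts⟩ := ih _ (Finset.erase_ssubset hf)
      refine ⟨t, ht, hts.trans ?_⟩
      ext x
      constructor
      · intro hx g hg
        by_cases hgf : g = f
        · subst hgf
          by_contra! hlt
          obtain ⟨g', hg', hne, hneg⟩ := h x hlt
          exact absurd (hx g' (Finset.mem_erase.2 ⟨hne, hg'⟩)) (not_le.2 hneg)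
        · exact hx g (Finset.mem_erase.2 ⟨hgf, hg⟩)
      · exact fun hx g hg => hx g (Finset.mem_of_mem_erase hg)

/-- Finitely many strict linear inequalities persist under small moves in both directions. -/
lemma exists_pos_perturb (t : Finset (Dual ℝ V)) {p : V} (hp : ∀ f ∈ t, 0 < f p) (v : V) :
    ∃ ε : ℝ, 0 < ε ∧ ∀ f ∈ t, 0 < f (p + ε • v) ∧ 0 < f (p - ε • v) := by
  classical
  induction t using Finset.induction_on with
  | empty => exact ⟨1, one_pos, by simp⟩
  | insert g t _ ih =>
    obtain ⟨ε, hε, h⟩ := ih fun f hf => hp f (Finset.mem_insert_of_mem hf)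
    have hg := hp g (Finset.mem_insert_self _ _)
    have key : ∀ f : Dual ℝ V, ∀ δ : ℝ, 0 < δ →
        ((0 < f (p + δ • v) ∧ 0 < f (p - δ • v)) ↔ δ * |f v| < f p) := by
      intro f δ hδ
      have : δ * |f v| = |δ * f v| := by rw [abs_mul, abs_of_pos hδ]
      rw [this, abs_lt]
      simp only [map_add, map_sub, map_smul, smul_eq_mul]
      constructor
      · rintro ⟨h1, h2⟩
        constructor <;> linarith
      · rintro ⟨h1, h2⟩
        constructor <;> linarith
    have hd : 0 < |g v| + 1 := by positivity
    refine ⟨min ε (g p / (|g v| + 1)), lt_min hε (by positivity), ?_⟩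
    have hm : 0 < min ε (g p / (|g v| + 1)) := lt_min hε (by positivity)
    intro f hf
    rw [key f _ hm]
    rcases Finset.mem_insert.1 hf with rfl | hf
    · calc _ ≤ f p / (|f v| + 1) * |f v| := by gcongr; exact min_le_right _ _
        _ < f p / (|f v| + 1) * (|f v| + 1) := by gcongr; linarith
        _ = f p := by field_simp
    · calc _ ≤ ε * |f v| := by gcongr; exact min_le_left _ _
        _ < f p := (key f ε hε).1 (h f hf)

/-- A supporting hyperplane of a cone passes through the origin. Taking `l = 0` covers the improper
face as well. -/
lemma IsPolyFace.exists_functional (hF : IsPolyFace (polyCone s) F) :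
    ∃ l : Dual ℝ V, (∀ x ∈ polyCone s, 0 ≤ l x) ∧ F = {x | x ∈ polyCone s ∧ l x = 0} := by
  rcases hF with rfl | ⟨⟨x, hx⟩, l, a, -, hl, rfl⟩
  · exact ⟨0, by simp, by simp⟩
  · have h0 : a ≤ 0 := by simpa using hl 0 (zero_mem_polyCone s)
    have h2 : a ≤ 2 * l x := by
      simpa using hl _ (smul_mem_polyCone hx.1 (zero_le_two (α := ℝ)))
    obtain rfl : a = 0 := by
      have := hx.2
      linarith
    exact ⟨l, hl, rfl⟩

lemma IsPolyFace.subset (hF : IsPolyFace (polyCone s) F) : F ⊆ polyCone s := by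
  obtain ⟨l, -, rfl⟩ := hF.exists_functional
  exact fun x hx => hx.1

lemma IsPolyFace.zero_mem (hF : IsPolyFace (polyCone s) F) : (0 : V) ∈ F := by
  obtain ⟨l, -, rfl⟩ := hF.exists_functional
  exact ⟨zero_mem_polyCone s, by simp⟩

lemma isPolyFace_polyFacet {f : Dual ℝ V} (hf : f ∈ s) (h0 : f ≠ 0) :
    IsPolyFace (polyCone s) (polyFacet s f) :=
  Or.inr ⟨⟨0, zero_mem_polyCone s, by simp⟩, f, 0, h0, fun x hx => hx f hf, rfl⟩

lemma hullDim_eq_finrank_span (h0 : (0 : V) ∈ F) : hullDim F = finrank ℝ (Submodule.span ℝ F) := by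
  have himg : (fun x => x -ᵥ (0 : V)) '' F = F := by simp
  rw [hullDim, direction_affineSpan, vectorSpan_eq_span_vsub_set_right ℝ h0, himg]

/-- A relative interior point of a face: it lies strictly inside every inequality that does not hold
with equality on the whole face. -/
lemma IsPolyFace.exists_relInterior (hF : IsPolyFace (polyCone s) F) :
    ∃ p ∈ F, ∀ f ∈ s, f ∉ activeSet s F → 0 < f p := by
  classical
  obtain ⟨l, hl, hFl⟩ := hF.exists_functional
  have hx : ∀ f : Dual ℝ V, ∃ x ∈ F, f ∈ s → f ∉ activeSet s F → 0 < f x := by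
    intro f
    by_cases h : f ∈ s ∧ f ∉ activeSet s F
    · have h' := h.2
      simp only [mem_activeSet, h.1, true_and, not_forall] at h'
      obtain ⟨x, hx, hne⟩ := h'
      exact ⟨x, hx, fun _ _ => lt_of_le_of_ne (hF.subset hx f h.1) (Ne.symm hne)⟩
    · exact ⟨0, hF.zero_mem, fun h1 h2 => absurd ⟨h1, h2⟩ h⟩
  choose x hxF hxpos using hx
  refine ⟨∑ f ∈ s, x f, ?_, fun f hf hfa => ?_⟩
  · rw [hFl]
    refine ⟨sum_mem_polyCone fun f _ => hF.subset (hxF f), ?_⟩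
    rw [map_sum]
    refine Finset.sum_eq_zero fun f _ => ?_
    have := hxF f
    rw [hFl] at this
    exact this.2
  · rw [map_sum]
    exact Finset.sum_pos' (fun g _ => hF.subset (hxF g) f hf) ⟨f, hf, hxpos f hf hfa⟩

lemma IsPolyFace.span_eq (hF : IsPolyFace (polyCone s) F) :
    Submodule.span ℝ F =
      (Submodule.span ℝ (activeSet s F : Set (Dual ℝ V))).dualCoannihilator := by
  classical
  apply le_antisymm
  · rw [Submodule.span_le]
    intro x hx
    rw [SetLike.mem_coe, Submodule.mem_dualCoannihilator]
    intro φ hφ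
    induction hφ using Submodule.span_induction with
    | mem f hf => exact (mem_activeSet.1 hf).2 x hx
    | zero => simp
    | add f g _ _ hf hg => simp [hf, hg]
    | smul a f _ hf => simp [hf]
  · intro v hv
    rw [Submodule.mem_dualCoannihilator] at hv
    obtain ⟨p, hpF, hp⟩ := hF.exists_relInterior
    obtain ⟨l, hl, hFl⟩ := hF.exists_functional
    obtain ⟨ε, hε, h⟩ := exists_pos_perturb (s \ activeSet s F) (p := p)
      (fun f hf => hp f (Finset.mem_sdiff.1 hf).1 (Finset.mem_sdiff.1 hf).2) v
    have hmem : p + ε • v ∈ polyCone s ∧ p - ε • v ∈ polyCone s := by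
      constructor <;>
      · intro f hf
        by_cases hfa : f ∈ activeSet s F
        · simp [hv f (Submodule.subset_span hfa), (mem_activeSet.1 hfa).2 p hpF]
        · have := h f (Finset.mem_sdiff.2 ⟨hf, hfa⟩)
          first | exact this.1.le | exact this.2.le
    have hlp : l p = 0 := by
      rw [hFl] at hpF
      exact hpF.2
    -- `l` is nonnegative at both ends of a segment with midpoint `p`, and `l p = 0`
    have hlv : l (p + ε • v) = 0 := by
      have h1 := hl _ hmem.1
      have h2 := hl _ hmem.2
      simp only [map_add, map_sub, hlp] at h1 h2 ⊢
      linarith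
    have hq : p + ε • v ∈ F := by
      rw [hFl]
      exact ⟨hmem.1, hlv⟩
    have : v = ε⁻¹ • ((p + ε • v) - p) := by
      rw [add_sub_cancel_left, inv_smul_smul₀ hε.ne']
    rw [this]
    exact Submodule.smul_mem _ _
      (Submodule.sub_mem _ (Submodule.subset_span hq) (Submodule.subset_span hpF))

lemma IsPolyFace.eq_setOf_activeSet (hF : IsPolyFace (polyCone s) F) :
    F = {x | x ∈ polyCone s ∧ ∀ f ∈ activeSet s F, f x = 0} := by
  apply Set.Subset.antisymm
  · exact fun x hx => ⟨hF.subset hx, fun f hf => (mem_activeSet.1 hf).2 x hx⟩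
  · rintro x ⟨hx, h⟩
    obtain ⟨l, hl, hFl⟩ := hF.exists_functional
    have hxs : x ∈ Submodule.span ℝ F := by
      rw [hF.span_eq, Submodule.mem_dualCoannihilator]
      intro φ hφ
      induction hφ using Submodule.span_induction with
      | mem f hf => exact h f hf
      | zero => simp
      | add f g _ _ hf hg => simp [hf, hg]
      | smul a f _ hf => simp [hf]
    have hle : Submodule.span ℝ F ≤ LinearMap.ker l := by
      rw [Submodule.span_le]
      intro y hy
      rw [hFl] at hy
      exact hy.2
    rw [hFl]
    exact ⟨hx, hle hxs⟩

lemma IsIrredundant.ne_zero (hs : IsIrredundant s) {f : Dual ℝ V} (hf : f ∈ s) : f ≠ 0 := by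
  rintro rfl
  obtain ⟨y, hy, -⟩ := hs 0 hf
  simp at hy

lemma subset_polyFacet_iff (hF : F ⊆ polyCone s) {f : Dual ℝ V} (hf : f ∈ s) :
    F ⊆ polyFacet s f ↔ f ∈ activeSet s F := by
  rw [mem_activeSet]
  exact ⟨fun h => ⟨hf, fun x hx => (h hx).2⟩, fun h x hx => ⟨hF hx, h.2 x hx⟩⟩

variable [FiniteDimensional ℝ V]

lemma IsPolyFace.finrank_span_activeSet_add_hullDim (hF : IsPolyFace (polyCone s) F) :
    finrank ℝ (Submodule.span ℝ (activeSet s F : Set (Dual ℝ V))) + hullDim F = finrank ℝ V := by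
  rw [hullDim_eq_finrank_span hF.zero_mem, hF.span_eq]
  exact Subspace.finrank_add_finrank_dualCoannihilator_eq _

lemma faceCodim_eq (hfull : hullDim (polyCone s) = finrank ℝ V)
    (hF : IsPolyFace (polyCone s) F) :
    faceCodim (polyCone s) F =
      finrank ℝ (Submodule.span ℝ (activeSet s F : Set (Dual ℝ V))) := by
  have := hF.finrank_span_activeSet_add_hullDim
  rw [faceCodim, hfull]
  omega

/-- A full-dimensional cone has a point at which all nonzero defining functionals are positive. -/
lemma exists_interior (hfull : hullDim (polyCone s) = finrank ℝ V) (hs : IsIrredundant s) :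
    ∃ z, ∀ f ∈ s, 0 < f z := by
  have hC : IsPolyFace (polyCone s) (polyCone s) := Or.inl rfl
  obtain ⟨z, -, hz⟩ := hC.exists_relInterior
  refine ⟨z, fun f hf => hz f hf fun hfa => hs.ne_zero hf ?_⟩
  have h := hC.finrank_span_activeSet_add_hullDim
  have h0 : Submodule.span ℝ (activeSet s (polyCone s) : Set (Dual ℝ V)) = ⊥ := by
    rw [← Submodule.finrank_eq_zero (R := ℝ)]
    omega
  exact (Submodule.mem_bot ℝ).1 (h0 ▸ Submodule.subset_span hfa)

/-- A relative interior point of the facet cut out by `f`. -/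
lemma exists_facet_interior (hfull : hullDim (polyCone s) = finrank ℝ V) (hs : IsIrredundant s)
    {f : Dual ℝ V} (hf : f ∈ s) : ∃ w, f w = 0 ∧ ∀ g ∈ s, g ≠ f → 0 < g w := by
  obtain ⟨z, hz⟩ := exists_interior hfull hs
  obtain ⟨y, hy, hyg⟩ := hs f hf
  -- the point where the segment from the interior point `z` to `y` meets `ker f`, up to scaling
  refine ⟨f z • y - f y • z, by simp [mul_comm], fun g hg hne => ?_⟩
  have h1 := mul_nonneg (hz f hf).le (hyg g hg hne)
  have h2 := mul_neg_of_neg_of_pos hy (hz g hg)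
  simp only [map_sub, map_smul, smul_eq_mul]
  linarith

lemma polyFacet_subset_iff (hfull : hullDim (polyCone s) = finrank ℝ V) (hs : IsIrredundant s)
    {f g : Dual ℝ V} (hf : f ∈ s) (hg : g ∈ s) : polyFacet s f ⊆ polyFacet s g ↔ f = g := by
  refine ⟨fun h => ?_, fun h => h ▸ subset_rfl⟩
  by_contra hne
  obtain ⟨w, hw, hwg⟩ := exists_facet_interior hfull hs hf
  have hmem : w ∈ polyFacet s f := by
    refine ⟨fun k hk => ?_, hw⟩
    by_cases hkf : k = f
    · rw [hkf, hw]
    · exact (hwg k hk hkf).le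
  exact (hwg g hg (Ne.symm hne)).ne' (h hmem).2

lemma polyFacet_injOn (hfull : hullDim (polyCone s) = finrank ℝ V) (hs : IsIrredundant s) :
    Set.InjOn (polyFacet s) s :=
  fun _ hf _ hg h => (polyFacet_subset_iff hfull hs hf hg).1 h.subset

lemma activeSet_polyFacet (hfull : hullDim (polyCone s) = finrank ℝ V) (hs : IsIrredundant s)
    {f : Dual ℝ V} (hf : f ∈ s) : activeSet s (polyFacet s f) = {f} := by
  ext g
  rw [Finset.mem_singleton, mem_activeSet]
  constructor
  · rintro ⟨hg, h⟩
    exact ((polyFacet_subset_iff hfull hs hf hg).1 fun x hx => ⟨hx.1, h x hx⟩).symm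
  · rintro rfl
    exact ⟨hf, fun x hx => hx.2⟩

/-- The facets of a full-dimensional cone are cut out by the functionals of an irredundant
description. -/
lemma isPolyFacet_iff (hfull : hullDim (polyCone s) = finrank ℝ V) (hs : IsIrredundant s)
    {H : Set V} : IsPolyFacet (polyCone s) H ↔ ∃ f ∈ s, H = polyFacet s f := by
  constructor
  · rintro ⟨hH, hdim⟩
    have h1 := hH.finrank_span_activeSet_add_hullDim
    have h1' : finrank ℝ (Submodule.span ℝ (activeSet s H : Set (Dual ℝ V))) = 1 := by omega
    obtain ⟨f, hfa⟩ : (activeSet s H).Nonempty := by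
      rw [Finset.nonempty_iff_ne_empty]
      intro h
      rw [h, Finset.coe_empty, Submodule.span_empty, finrank_bot] at h1'
      exact zero_ne_one h1'
    have hf := (mem_activeSet.1 hfa).1
    refine ⟨f, hf, ?_⟩
    rw [hH.eq_setOf_activeSet]
    ext x
    refine ⟨fun hx => ⟨hx.1, hx.2 f hfa⟩, fun hx => ⟨hx.1, fun g hg => ?_⟩⟩
    -- the active functionals span a line, so each is a multiple of `f`
    have hv : (⟨f, Submodule.subset_span hfa⟩ :
        Submodule.span ℝ (activeSet s H : Set (Dual ℝ V))) ≠ 0 :=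
      fun h => hs.ne_zero hf (congrArg Subtype.val h)
    obtain ⟨a, ha⟩ := exists_smul_eq_of_finrank_eq_one h1' hv
      (⟨g, Submodule.subset_span hg⟩ : Submodule.span ℝ (activeSet s H : Set (Dual ℝ V)))
    have ha' : a • f = g := congrArg Subtype.val ha
    rw [← ha', LinearMap.smul_apply, hx.2, smul_zero]
  · rintro ⟨f, hf, rfl⟩
    have hH := isPolyFace_polyFacet hf (hs.ne_zero hf)
    refine ⟨hH, ?_⟩
    have h := hH.finrank_span_activeSet_add_hullDim
    rw [activeSet_polyFacet hfull hs hf, Finset.coe_singleton,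
      finrank_span_singleton (hs.ne_zero hf)] at h
    omega

lemma encard_facets_containing (hfull : hullDim (polyCone s) = finrank ℝ V)
    (hs : IsIrredundant s) (hF : IsPolyFace (polyCone s) F) :
    {H : Set V | IsPolyFacet (polyCone s) H ∧ F ⊆ H}.encard = (activeSet s F).card := by
  have himg : {H : Set V | IsPolyFacet (polyCone s) H ∧ F ⊆ H} =
      polyFacet s '' (activeSet s F : Set (Dual ℝ V)) := by
    ext H
    simp only [Set.mem_ofPred_eq, isPolyFacet_iff hfull hs, Set.mem_image, Finset.mem_coe]
    constructor
    · rintro ⟨⟨f, hf, rfl⟩, h⟩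
      exact ⟨f, (subset_polyFacet_iff hF.subset hf).1 h, rfl⟩
    · rintro ⟨f, hfa, rfl⟩
      have hf := (mem_activeSet.1 hfa).1
      exact ⟨⟨f, hf, rfl⟩, (subset_polyFacet_iff hF.subset hf).2 hfa⟩
  have hinj : Set.InjOn (polyFacet s) (activeSet s F : Set (Dual ℝ V)) :=
    (polyFacet_injOn hfull hs).mono fun f hf => (mem_activeSet.1 hf).1
  rw [himg, hinj.encard_image, Set.encard_coe_eq_coe_finsetCard]

/-- Intersections of facets of `C` correspond to subsets of an irredundant description. -/
lemma isInterOfFewerFacets_iff (hfull : hullDim (polyCone s) = finrank ℝ V)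
    (hs : IsIrredundant s) {k : ℕ} : IsInterOfFewerFacets (polyCone s) F k ↔
      ∃ T ⊆ s, T.card < k ∧ F = {x | x ∈ polyCone s ∧ ∀ f ∈ T, f x = 0} := by
  classical
  constructor
  · rintro ⟨S, hSk, hS, hFS⟩
    refine ⟨s.filter fun f => polyFacet s f ∈ S, Finset.filter_subset _ _, ?_, ?_⟩
    · refine (Finset.card_le_card_of_injOn (polyFacet s) ?_ ?_).trans_lt hSk
      · exact fun f hf => (Finset.mem_filter.1 hf).2
      · exact (polyFacet_injOn hfull hs).mono fun f hf => (Finset.mem_filter.1 hf).1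
    · rw [hFS]
      ext x
      simp only [Set.mem_inter_iff, Set.mem_iInter, Finset.mem_filter, Set.mem_ofPred_eq]
      refine and_congr_right fun hx => ⟨fun h f hf => (h _ hf.2).2, fun h H hH => ?_⟩
      obtain ⟨f, hf, rfl⟩ := (isPolyFacet_iff hfull hs).1 (hS H hH)
      exact ⟨hx, h f ⟨hf, hH⟩⟩
  · rintro ⟨T, hTs, hTk, hFT⟩
    refine ⟨T.image (polyFacet s), Finset.card_image_le.trans_lt hTk, ?_, ?_⟩
    · intro H hH
      obtain ⟨f, hf, rfl⟩ := Finset.mem_image.1 hH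
      exact (isPolyFacet_iff hfull hs).2 ⟨f, hTs hf, rfl⟩
    · rw [hFT]
      ext x
      simp only [Set.mem_inter_iff, Set.mem_iInter, Set.mem_ofPred_eq, Finset.mem_image,
        forall_exists_index, and_imp, forall_apply_eq_imp_iff₂]
      exact and_congr_right fun hx => ⟨fun h f hf => ⟨hx, h f hf⟩, fun h f hf => (h f hf).2⟩

/-- If the functionals vanishing on `F` are linearly independent, none of them can be omitted from a
description of `F` as an intersection of facets. -/
lemma not_isInterOfFewerFacets (hfull : hullDim (polyCone s) = finrank ℝ V)
    (hs : IsIrredundant s) (hF : IsPolyFace (polyCone s) F)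
    (hli : LinearIndepOn ℝ id (activeSet s F : Set (Dual ℝ V))) :
    ¬ IsInterOfFewerFacets (polyCone s) F (activeSet s F).card := by
  classical
  rw [isInterOfFewerFacets_iff hfull hs]
  rintro ⟨T, hTs, hTk, hFT⟩
  have hTa : T ⊆ activeSet s F := fun f hf => mem_activeSet.2 ⟨hTs hf, fun x hx => by
    rw [hFT] at hx
    exact hx.2 f hf⟩
  obtain ⟨f, hfa, hfT⟩ := Finset.exists_mem_notMem_of_card_lt_card hTk
  have hnot := hli.notMem_span (i := f) hfa
  rw [Set.image_id, id, ← Subspace.dualCoannihilator_dualAnnihilator_eq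
    (W := Submodule.span ℝ ((activeSet s F : Set (Dual ℝ V)) \ {f})),
    Submodule.mem_dualAnnihilator] at hnot
  push Not at hnot
  obtain ⟨v, hv, hfv⟩ := hnot
  have hv' : ∀ g ∈ activeSet s F, g ≠ f → g v = 0 := fun g hg hne =>
    (Submodule.mem_dualCoannihilator v).1 hv g (Submodule.subset_span ⟨hg, hne⟩)
  obtain ⟨p, hpF, hp⟩ := hF.exists_relInterior
  obtain ⟨ε, hε, h⟩ := exists_pos_perturb (s \ activeSet s F) (p := p)
    (fun f hf => hp f (Finset.mem_sdiff.1 hf).1 (Finset.mem_sdiff.1 hf).2) ((f v) • v)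
  have hact : ∀ g ∈ activeSet s F, g p = 0 := fun g hg => (mem_activeSet.1 hg).2 p hpF
  have hmem : p + ε • f v • v ∈ F := by
    rw [hFT]
    refine ⟨fun g hg => ?_, fun g hg => ?_⟩
    · by_cases hga : g ∈ activeSet s F
      · by_cases hgf : g = f
        · subst hgf
          simp only [map_add, map_smul, smul_eq_mul, hact g hga, zero_add]
          exact mul_nonneg hε.le (mul_self_nonneg _)
        · simp [hact g hga, hv' g hga hgf]
      · exact (h g (Finset.mem_sdiff.2 ⟨hg, hga⟩)).1.le
    · have hgf : g ≠ f := fun e => hfT (e ▸ hg)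
      simp [hact g (hTa hg), hv' g (hTa hg) hgf]
  have := (mem_activeSet.1 hfa).2 _ hmem
  simp [hact f hfa, hε.ne', hfv] at this

/-- If the functionals vanishing on `F` are linearly dependent, Radon's argument gives an
intersection of fewer than `codim F` facets that equals `F`. -/
lemma isInterOfFewerFacets (hfull : hullDim (polyCone s) = finrank ℝ V)
    (hs : IsIrredundant s) (hF : IsPolyFace (polyCone s) F)
    (hlt : finrank ℝ (Submodule.span ℝ (activeSet s F : Set (Dual ℝ V))) < (activeSet s F).card) :
    IsInterOfFewerFacets (polyCone s) F
      (finrank ℝ (Submodule.span ℝ (activeSet s F : Set (Dual ℝ V)))) := by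
  classical
  rw [isInterOfFewerFacets_iff hfull hs]
  obtain ⟨b', hb't, hspan, hli⟩ := exists_linearIndependent ℝ (activeSet s F : Set (Dual ℝ V))
  obtain ⟨b, rfl⟩ := ((activeSet s F).finite_toSet.subset hb't).exists_finset_coe
  have hbt : b ⊆ activeSet s F := hb't
  have hbcard : finrank ℝ (Submodule.span ℝ (activeSet s F : Set (Dual ℝ V))) = b.card := by
    rw [← hspan]
    exact finrank_span_finset_eq_card hli
  rw [hbcard] at hlt ⊢
  obtain ⟨e, he, heb⟩ := Finset.exists_mem_notMem_of_card_lt_card hlt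
  set u := insert e b with hu
  have hut : u ⊆ activeSet s F := Finset.insert_subset he hbt
  have hus : ∀ f ∈ u, f ∈ s := fun f hf => (mem_activeSet.1 (hut hf)).1
  have hucard : u.card = b.card + 1 := Finset.card_insert_of_notMem heb
  have hdep : ¬ LinearIndepOn ℝ id (u : Set (Dual ℝ V)) := by
    intro h
    have h1 := finrank_span_finset_eq_card h
    have h2 := Submodule.finrank_mono (R := ℝ) (Submodule.span_mono
      (show (u : Set (Dual ℝ V)) ⊆ activeSet s F from hut))
    omega
  rw [linearIndepOn_finset_iff] at hdep
  push Not at hdep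
  obtain ⟨c, hc, f₀, hf₀, hcf₀⟩ := hdep
  simp only [id] at hc
  have hrel : ∀ x : V, ∑ f ∈ u, c f * f x = 0 := fun x => by
    simpa using LinearMap.congr_fun hc x
  -- at least two coefficients of the relation are negative
  have hB : 1 < (u.filter fun f => c f < 0).card := by
    by_contra! hle
    obtain ⟨j, hj, hjpos⟩ : ∃ j ∈ u, ∀ f ∈ u, f ≠ j → 0 ≤ c f := by
      by_cases hne : (u.filter fun f => c f < 0).Nonempty
      · obtain ⟨j, hj⟩ := hne
        refine ⟨j, (Finset.mem_filter.1 hj).1, fun f hf hfj => ?_⟩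
        by_contra! hneg
        exact hfj (Finset.card_le_one.1 hle f (Finset.mem_filter.2 ⟨hf, hneg⟩) j hj)
      · refine ⟨f₀, hf₀, fun f hf _ => ?_⟩
        by_contra! hneg
        exact hne ⟨f, Finset.mem_filter.2 ⟨hf, hneg⟩⟩
    obtain ⟨w, hjw, hw⟩ := exists_facet_interior hfull hs (hus j hj)
    have hterm : ∀ f ∈ u, 0 ≤ c f * f w := by
      intro f hf
      by_cases hfj : f = j
      · simp [hfj, hjw]
      · exact mul_nonneg (hjpos f hf hfj) (hw f (hus f hf) hfj).le
    have hzero := (Finset.sum_eq_zero_iff_of_nonneg hterm).1 (hrel w)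
    have hc0 : ∀ f ∈ u, f ≠ j → c f = 0 := fun f hf hfj =>
      (mul_eq_zero.1 (hzero f hf)).resolve_right (hw f (hus f hf) hfj).ne'
    rw [Finset.sum_eq_single_of_mem j hj fun f hf hfj => by rw [hc0 f hf hfj, zero_smul]] at hc
    have hcj : c j = 0 := (smul_eq_zero.1 hc).resolve_right (hs.ne_zero (hus j hj))
    by_cases h0 : f₀ = j
    · exact hcf₀ (h0 ▸ hcj)
    · exact hcf₀ (hc0 f₀ hf₀ h0)
  refine ⟨u.filter fun f => ¬ c f < 0, fun f hf => hus f (Finset.mem_filter.1 hf).1, ?_, ?_⟩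
  · have := Finset.card_filter_add_card_filter_not (s := u) (fun f => c f < 0)
    omega
  · apply Set.Subset.antisymm
    · exact fun x hx => ⟨hF.subset hx, fun f hf =>
        (mem_activeSet.1 (hut (Finset.mem_filter.1 hf).1)).2 x hx⟩
    · rintro x ⟨hx, h⟩
      have hterm : ∀ f ∈ u, c f * f x ≤ 0 := by
        intro f hf
        by_cases hneg : c f < 0
        · exact mul_nonpos_of_nonpos_of_nonneg hneg.le (hx f (hus f hf))
        · rw [h f (Finset.mem_filter.2 ⟨hf, hneg⟩), mul_zero]
      have hzero := (Finset.sum_eq_zero_iff_of_nonpos hterm).1 (hrel x)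
      have hux : ∀ f ∈ u, f x = 0 := by
        intro f hf
        by_cases hneg : c f < 0
        · exact (mul_eq_zero.1 (hzero f hf)).resolve_left hneg.ne
        · exact h f (Finset.mem_filter.2 ⟨hf, hneg⟩)
      rw [hF.eq_setOf_activeSet]
      refine ⟨hx, fun f hf => ?_⟩
      have hle : Submodule.span ℝ (b : Set (Dual ℝ V)) ≤ LinearMap.ker (Dual.eval ℝ V x) := by
        rw [Submodule.span_le]
        exact fun g hg => hux g (Finset.mem_insert_of_mem hg)
      exact hle (hspan ▸ Submodule.subset_span hf)

end PolyCone

theorem propositionp (d : ℕ) (C : PointedCone ℝ (Fin d → ℝ))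
    (hpoly : PointedCone.DualFG
      (LinearMap.id : Module.Dual ℝ (Fin d → ℝ) →ₗ[ℝ] Module.Dual ℝ (Fin d → ℝ)) C)
    (hpointed : C.toConvexCone.Salient)
    (hfull : hullDim (C : Set (Fin d → ℝ)) = d)
    (F : Set (Fin d → ℝ)) (hF : IsPolyFace (C : Set (Fin d → ℝ)) F) :
    IsCosimplicialFace (C : Set (Fin d → ℝ)) F ↔
      ¬ IsInterOfFewerFacets (C : Set (Fin d → ℝ)) F (faceCodim (C : Set (Fin d → ℝ)) F) := by
  obtain ⟨s₀, hs₀⟩ := hpoly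
  obtain ⟨s, hs, hss₀⟩ := exists_isIrredundant s₀
  have hC : (C : Set (Fin d → ℝ)) = polyCone s := by
    rw [hss₀, ← hs₀]
    ext x
    simp [polyCone]
  rw [hC] at hfull hF ⊢
  have hfull' : hullDim (polyCone s) = finrank ℝ (Fin d → ℝ) := by simpa using hfull
  rw [IsCosimplicialFace, encard_facets_containing hfull' hs hF, faceCodim_eq hfull' hF,
    Nat.cast_inj]
  have hle : finrank ℝ (Submodule.span ℝ (activeSet s F : Set (Dual ℝ (Fin d → ℝ)))) ≤
      (activeSet s F).card := finrank_span_finset_le_card _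
  constructor
  · intro h
    rw [← h]
    refine not_isInterOfFewerFacets hfull' hs hF ?_
    refine linearIndependent_iff_card_eq_finrank_span.2 ?_
    refine (Fintype.card_coe _).trans (h.trans ?_)
    exact congrArg (Set.finrank ℝ) Subtype.range_coe.symm
  · intro h
    by_contra hne
    exact h (isInterOfFewerFacets hfull' hs hF (lt_of_le_of_ne hle (Ne.symm hne)))
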